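/- Let $I$ be a finite set of agents, $S$ a compact metric space of states of nature with a Borel probability measure $\mathbf P$, and for every $l\in I$ let $A_l$ be a nonempty compact metric space of strategies and $U_l:\prod_{m\in I}A_m\times S\to\mathbb R$ a utility function that is measurable in the state; write $\tilde U_l(a)=U_l(a,\cdot)$ and $A_{-l}=\prod_{m\ne l}A_m$. For a compact metric space $X$, $\Delta(X)$ is the space of Borel probability measures on $X$ with the weak topology, and the support of a measure is the smallest closed set of full measure. *Hierarchies.* Put $Y_l^0=S\times A_{-l}$, $B_l^{k}=\Delta(Y_l^{k-1})$ and $Y_l^{k}=Y_l^{k-1}\times\prod_{m\neq l}B_m^{k}$ for $k\ge1$. Let $B_l\subseteq\prod_{k\ge1}B_l^k$ be the set of consistent belief hierarchies $b_l=(b_l^1,b_l^2,\dots)$ of agent $l$, i.e. those that satisfy coherence ($\mathrm{marg}_{Y_l^{k-1}}b_l^{k+1}=b_l^k$ for $k\ge 1$) and common knowledge of coherence, and let $\phi_l:B_l\to\Delta(S\times A_{-l}\times\prod_{m\ne l}B_m)$ be the canonical map, for which $\mathrm{marg}_{Y_l^{k-1}}\phi_l(b_l)=b_l^k$ for all $k\ge1$.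 *Undominated sets and hierarchy sets.* For $a_l,a_l^*\in A_l$ and $a_{-l}\in A_{-l}$, say that $a_l^*$ improves on $a_l$ against $a_{-l}$ if $\tilde U_l(a_l^*,a_{-l})\ge\tilde U_l(a_l,a_{-l})$ $\mathbf P$-a.s. and $\mathbf P[\tilde U_l(a_l^*,a_{-l})>\tilde U_l(a_l,a_{-l})]>0$. Put $\mathcal{UD}_l^0=A_l$ and $W_l^1=B_l$, let $\mathcal D_l^1$ be the set of $a_l\in A_l$ such that for every $a_{-l}\in A_{-l}$ some $a_l^*\in A_l$ improves on $a_l$ against $a_{-l}$, and, for all agents simultaneously, put $\mathcal{UD}_l^{k}=\mathcal{UD}_l^{k-1}\setminus\mathcal D_l^{k}$ for $k\ge1$ and, for $k\geq 2$: - $V_l^k$ is the set of $b_l\in W_l^{k-1}$ such that $\mathrm{marg}_{A_m}[\phi_l(b_l)](\mathcal D_m^{k-1})=0$ for all $m\neq l$; - $W_l^k$ is the set of $b_l\in V_l^k$ such that $\mathrm{marg}_{A_l}[\beta](\mathcal D_l^{k-1})=0$ for all $m\ne l$ and all $\beta\in\mathrm{supp}\,\mathrm{marg}_{B_m^{k-1}}[\phi_l(b_l)]$;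 - $\mathcal D_l^k$ is the set of $a_l\in\mathcal{UD}_l^{k-1}$ such that for every $b_l\in W_l^k$ and every $a_{-l}\in\mathrm{supp}\,\mathrm{marg}_{A_{-l}}[\phi_l(b_l)]$ some $a_l^*\in A_l$ improves on $a_l$ against $a_{-l}$. (Probability zero is meant as outer measure zero for sets that are not measurable.) *Statement.* Let $i\ne j$ be agents, and for $k\ge 1$ let $$A_j(W_i^k)=\{a_j\in A_j: a_j\in\mathrm{supp}\,\mathrm{marg}_{A_j}[\phi_i(b_i)]\text{ for some }b_i\in W_i^k\}$$ be the set of strategies that agent $i$ deems plausible for agent $j$ under hierarchies in $W_i^k$. Then: 1. $A_j\supseteq A_j(W_i^1)\supseteq A_j(W_i^2)\supseteq\dots\supseteq A_j(W_i^{k-1})\supseteq A_j(W_i^k)\supseteq\dots$. 2. If $k\ge1$ and the sets $\mathcal{UD}_l^{k-1}$, $l\in I$, are nonempty, then $A_j(W_i^k)$ is the closure of $\mathcal{UD}_j^{k-1}$ in $A_j$. 3. Hence, in the situation of 2, $A_j(W_i^k)=\mathcal{UD}_j^{k-1}$ if and only if $\mathcal{UD}_j^{k-1}$ is closed. 4.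 If for every $l\in I$, $a_{-l}\in A_{-l}$ and $s\in S$ the function $a_l\mapsto U_l(a_l,a_{-l},s)$ is upper semicontinuous, then all the sets $\mathcal{UD}_l^k$ are nonempty, so 2 and 3 apply for every $k\ge1$. -/

import Mathlib

open MeasureTheory Topology

universe u v w

noncomputable section

namespace Epistemic

/-! ### Borel probability measures, marginals and supports -/

/-- `Δ X`: the Borel probability measures on a topological space `X`. -/
def Bel (X : Type*) [TopologicalSpace X] : Type _ :=
  @ProbabilityMeasure X (borel X)

namespace Bel

variable {X Z : Type*} [TopologicalSpace X] [TopologicalSpace Z]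

/-- The topology of weak convergence on `Δ X`. -/
instance : TopologicalSpace (Bel X) :=
  @ProbabilityMeasure.instTopologicalSpace X (borel X) _ (@BorelSpace.opensMeasurable X _ (borel X) (@BorelSpace.mk X _ (borel X) rfl))

/-- The underlying Borel measure. -/
def toMeasure (μ : Bel X) : @Measure X (borel X) := Subtype.val μ

/-- The image of a belief under a continuous map; for a coordinate projection `f` this is the
marginal on the target of `f`. -/
def marg (f : C(X, Z)) (μ : Bel X) : Bel Z :=
  @ProbabilityMeasure.map X Z (borel X) (borel Z) μ f
    (@Measurable.aemeasurable X Z (borel X) (borel Z) f _ f.continuous.borel_measurable)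

/-- The support of a belief. -/
def supp (μ : Bel X) : Set X := @Measure.support X _ (borel X) μ.toMeasure

/-- The belief `μ` gives probability zero to `E`. -/
def IsNull (μ : Bel X) (E : Set X) : Prop := μ.toMeasure E = 0

theorem marg_apply (f : C(X, Z)) (μ : Bel X) {E : Set Z} (hE : MeasurableSet[borel Z] E) :
    (marg f μ).toMeasure E = μ.toMeasure (f ⁻¹' E) :=
  @Measure.map_apply X Z (borel X) (borel Z) μ.toMeasure f f.continuous.borel_measurable E hE

theorem marg_marg {T : Type*} [TopologicalSpace T] (g : C(Z, T)) (f : C(X, Z)) (μ : Bel X) :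
    marg g (marg f μ) = marg (g.comp f) μ := by
  apply Subtype.ext
  exact @Measure.map_map X Z T (borel X) (borel Z) (borel T) μ.toMeasure g f
    g.continuous.borel_measurable f.continuous.borel_measurable

end Bel

/-! ### Belief hierarchies -/

section Hierarchies

variable (S : Type u) {I : Type v} (A : I → Type w)
  [TopologicalSpace S] [∀ j, TopologicalSpace (A j)]

/-- `A_{-i}`, the strategy profiles of the agents other than `i`. -/
abbrev Opp (i : I) : Type (max v w) := ∀ j : {j : I // j ≠ i}, A j

/-- The state space `Y_i^k` of the layer-`k` uncertainty of agent `i`: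
`Y_i^0 = S × ∏_{j ≠ i} A_j` and `Y_i^{k+1} = Y_i^k × ∏_{j ≠ i} B_j^{k+1}`,
where `B_j^{k+1} = Δ(Y_j^k)`. -/
def Layer : ℕ → I → TopCat.{max u v w}
  | 0, i => TopCat.of (S × Opp A i)
  | k + 1, i => TopCat.of (Layer k i × (∀ j : {j : I // j ≠ i}, Bel (Layer k j)))

/-- The set `B_i^{k+1} = Δ(Y_i^k)` of beliefs of order `k + 1` of agent `i`. -/
abbrev Order (k : ℕ) (i : I) : Type (max u v w) := Bel (Layer S A k i)

/-- All sequences `(b_i^1, b_i^2, …)` in `∏_k B_i^{k+1}`: the entry with index `k` is the belief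
of order `k + 1`. The belief of order zero is the fixed measure on `S` that is common to all
agents, so it is not recorded. -/
abbrev Hier (i : I) : Type (max u v w) := ∀ k : ℕ, Order S A k i

/-- The projection `Y_i^{k+1} → Y_i^k`. -/
def Layer.down (k : ℕ) (i : I) : C(Layer S A (k + 1) i, Layer S A k i) :=
  (ContinuousMap.fst : C(Layer S A k i × (∀ j : {j : I // j ≠ i}, Order S A k j), Layer S A k i))

/-- The projection `Y_i^{k+1} → B_j^{k+1}` for `j ≠ i`. -/
def Layer.top (k : ℕ) (i : I) (j : {j : I // j ≠ i}) :
    C(Layer S A (k + 1) i, Order S A k j) :=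
  (ContinuousMap.mk (fun y => y.2 j) :
    C(Layer S A k i × (∀ j : {j : I // j ≠ i}, Order S A k j), Order S A k j))

/-- The projection `Y_i^k → A_{-i}`. -/
def Layer.act : ∀ (k : ℕ) (i : I), C(Layer S A k i, Opp A i)
  | 0, i => (ContinuousMap.snd : C(S × Opp A i, Opp A i))
  | k + 1, i => (Layer.act k i).comp (Layer.down S A k i)

/-- The projection `A_{-i} → A_j` for `j ≠ i`. -/
def Opp.coord {i : I} (j : {j : I // j ≠ i}) : C(Opp A i, A j) :=
  ⟨fun a => a j, continuous_apply j⟩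

variable {S A}

/-- A hierarchy is coherent if `marg_{Y_i^{k-1}} b_i^{k+1} = b_i^k` for all `k ≥ 1`. -/
def Coherent {i : I} (b : Hier S A i) : Prop :=
  ∀ k : ℕ, Bel.marg (Layer.down S A k i) (b (k + 1)) = b k

/-- `S × ∏_{j ≠ i} A_j × ∏_{j ≠ i} C_j`, for sets `C_j` of hierarchies. -/
abbrev States (C : ∀ j : I, Set (Hier S A j)) (i : I) : Type (max u v w) :=
  (S × Opp A i) × (∀ j : {j : I // j ≠ i}, C j)

/-- The projection of `S × ∏_{j ≠ i} A_j × ∏_{j ≠ i} C_j` to `Y_i^k`. -/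
def States.proj (C : ∀ j : I, Set (Hier S A j)) (i : I) :
    ∀ k : ℕ, C(States C i, Layer S A k i)
  | 0 => (ContinuousMap.fst : C(States C i, S × Opp A i))
  | k + 1 =>
    (ContinuousMap.mk (fun ω => (States.proj C i k ω, fun j => (ω.2 j).1 k))
      ((States.proj C i k).continuous.prodMk (continuous_pi fun j =>
        (continuous_apply k).comp (continuous_subtype_val.comp
          ((continuous_apply j).comp continuous_snd)))) :
      C(States C i, Layer S A k i × (∀ j : {j : I // j ≠ i}, Order S A k j)))

/-- A family `C` of sets of hierarchies is belief-closed if every hierarchy in it is coherent and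
is induced by a belief on `S × ∏_{j ≠ i} A_j × ∏_{j ≠ i} C_j`: all its members are certain that
the hierarchies of the others are in `C` as well. -/
def BeliefClosed (C : ∀ j : I, Set (Hier S A j)) : Prop :=
  ∀ (i : I), ∀ b ∈ C i, Coherent b ∧
    ∃ μ : Bel (States C i), ∀ k, Bel.marg (States.proj C i k) μ = b k

variable (S A) in
/-- The set `B_i` of consistent hierarchies, that is, of those which reflect coherence and common
knowledge of coherence: the largest belief-closed family. -/
def Consistent (i : I) : Set (Hier S A i) :=
  {b | ∃ C : ∀ j : I, Set (Hier S A j), BeliefClosed C ∧ b ∈ C i}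

/-- The map between state spaces that comes from inclusions of sets of hierarchies. -/
def States.incl {C D : ∀ j : I, Set (Hier S A j)} (h : ∀ j, C j ⊆ D j) (i : I) :
    C(States C i, States D i) where
  toFun ω := (ω.1, fun j => ⟨(ω.2 j).1, h j (ω.2 j).2⟩)
  continuous_toFun := by fun_prop

theorem States.proj_comp_incl {C D : ∀ j : I, Set (Hier S A j)} (h : ∀ j, C j ⊆ D j) (i : I)
    (k : ℕ) : (States.proj D i k).comp (States.incl h i) = States.proj C i k := by
  induction k with
  | zero => rfl
  | succ k ih =>
    ext ω
    have := congrArg (fun f => f ω) ih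
    exact Prod.ext this rfl

theorem beliefClosed_consistent : BeliefClosed (Consistent S A) := by
  rintro i b ⟨C, hC, hb⟩
  obtain ⟨h1, μ, hμ⟩ := hC i b hb
  have h : ∀ j, C j ⊆ Consistent S A j := fun j c hc => ⟨C, hC, hc⟩
  refine ⟨h1, Bel.marg (States.incl h i) μ, fun k => ?_⟩
  rw [Bel.marg_marg, States.proj_comp_incl, hμ]

/-- The topology of the state space is the one generated by the projections to the layers. -/
theorem States.topology_eq (C : ∀ j : I, Set (Hier S A j)) (i : I) :
    (inferInstance : TopologicalSpace (States C i)) =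
      ⨅ k, TopologicalSpace.induced (States.proj C i k) inferInstance := by
  apply le_antisymm
  · exact le_iInf fun k => continuous_iff_le_induced.1 (States.proj C i k).continuous
  · have hp : ∀ k, Continuous[⨅ k, TopologicalSpace.induced (States.proj C i k) inferInstance,
        inferInstance] (States.proj C i k) := fun k =>
      continuous_iff_le_induced.2 (iInf_le _ k)
    rw [← continuous_id_iff_le]
    let _ : TopologicalSpace (States C i) :=
      ⨅ k, TopologicalSpace.induced (States.proj C i k) inferInstance
    have h0 : Continuous (fun ω : States C i => ω.1) := hp 0
    have h1 : Continuous (fun ω : States C i => ω.2) := by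
      refine continuous_pi fun j => Continuous.subtype_mk (continuous_pi fun k => ?_) _
      exact (Layer.top S A k i j).continuous.comp (hp (k + 1))
    exact h0.prodMk h1

theorem States.down_comp_proj (C : ∀ j : I, Set (Hier S A j)) (i : I) (k : ℕ) :
    (Layer.down S A k i).comp (States.proj C i (k + 1)) = States.proj C i k := rfl

theorem States.induced_antitone (C : ∀ j : I, Set (Hier S A j)) (i : I) :
    Antitone fun k => TopologicalSpace.induced (States.proj C i k) inferInstance := by
  refine antitone_nat_of_succ_le fun k => ?_
  rw [← States.down_comp_proj C i k, ContinuousMap.coe_comp, ← induced_compose]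
  exact induced_mono (continuous_iff_le_induced.1 (Layer.down S A k i).continuous)

theorem States.isOpen_eq_iUnion (C : ∀ j : I, Set (Hier S A j)) (i : I) {U : Set (States C i)}
    (hU : IsOpen U) : ∃ V : ∀ k, Set (Layer S A k i), (∀ k, IsOpen (V k)) ∧
      Monotone (fun k => States.proj C i k ⁻¹' V k) ∧ U = ⋃ k, States.proj C i k ⁻¹' V k := by
  have hmono := States.induced_antitone C i
  refine ⟨fun k => ⋃₀ {O | IsOpen O ∧ States.proj C i k ⁻¹' O ⊆ U},
    fun k => isOpen_sUnion fun O hO => hO.1, ?_, ?_⟩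
  · refine monotone_nat_of_le_succ fun k ω hω => ?_
    obtain ⟨O, ⟨hO, hOU⟩, hωO⟩ := hω
    exact ⟨Layer.down S A k i ⁻¹' O, ⟨hO.preimage (Layer.down S A k i).continuous, hOU⟩, hωO⟩
  · apply subset_antisymm
    · intro ω hω
      have h1 : U ∈ @nhds _ (⨅ k, TopologicalSpace.induced (States.proj C i k) inferInstance) ω := by
        rw [← States.topology_eq C i]
        exact hU.mem_nhds hω
      rw [nhds_iInf, Filter.mem_iInf_of_directed] at h1
      · obtain ⟨k, hk⟩ := h1
        rw [nhds_induced] at hk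
        obtain ⟨N, hN, hNU⟩ := hk
        obtain ⟨O, hON, hO, hωO⟩ := mem_nhds_iff.1 hN
        exact Set.mem_iUnion.2 ⟨k, O, ⟨hO, (Set.preimage_mono hON).trans hNU⟩, hωO⟩
      · intro k l
        exact ⟨max k l, nhds_mono (hmono (le_max_left k l)), nhds_mono (hmono (le_max_right k l))⟩
    · refine Set.iUnion_subset fun k ω hω => ?_
      obtain ⟨O, ⟨_, hOU⟩, hωO⟩ := hω
      exact hOU hωO

/-- A belief on the state space is determined by its marginals on the layers. -/
theorem States.bel_ext (C : ∀ j : I, Set (Hier S A j)) (i : I) {μ ν : Bel (States C i)}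
    (h : ∀ k, Bel.marg (States.proj C i k) μ = Bel.marg (States.proj C i k) ν) : μ = ν := by
  apply Subtype.ext
  let _ : MeasurableSpace (States C i) := borel _
  have : BorelSpace (States C i) := ⟨rfl⟩
  change μ.toMeasure = ν.toMeasure
  have : IsProbabilityMeasure μ.toMeasure := μ.2
  have : IsProbabilityMeasure ν.toMeasure := ν.2
  refine ext_of_generate_finite {U : Set (States C i) | IsOpen U} rfl isPiSystem_isOpen ?_
    (by simp)
  intro U hU
  obtain ⟨V, hV, hVm, rfl⟩ := States.isOpen_eq_iUnion C i hU
  rw [hVm.measure_iUnion, hVm.measure_iUnion]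
  refine iSup_congr fun k => ?_
  have hm : MeasurableSet[borel (Layer S A k i)] (V k) :=
    MeasurableSpace.measurableSet_generateFrom (hV k)
  exact (Bel.marg_apply _ μ hm).symm.trans ((congrArg (fun m => m.toMeasure (V k)) (h k)).trans
    (Bel.marg_apply _ ν hm))

variable (S A) in
/-- The total domain of uncertainty `Ω_i = S × ∏_{j ≠ i} A_j × ∏_{j ≠ i} B_j` of agent `i`. -/
abbrev Total (i : I) : Type (max u v w) := States (Consistent S A) i

theorem existsUnique_phi {i : I} (b : Consistent S A i) :
    ∃! μ : Bel (Total S A i), ∀ k, Bel.marg (States.proj (Consistent S A) i k) μ = b.1 k := by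
  obtain ⟨μ, hμ⟩ := (beliefClosed_consistent i b.1 b.2).2
  exact ⟨μ, hμ, fun ν hν => States.bel_ext _ _ fun k => (hν k).trans (hμ k).symm⟩

/-- The canonical map `φ_i : B_i → Δ(S × ∏_{j ≠ i} A_j × ∏_{j ≠ i} B_j)`: the measure `φ_i(b_i)`
is the only one whose marginal on `Y_i^{k-1}` is `b_i^k` for every `k ≥ 1`. -/
def phi {i : I} (b : Consistent S A i) : Bel (Total S A i) := (existsUnique_phi b).choose

theorem marg_phi {i : I} (b : Consistent S A i) (k : ℕ) :
    Bel.marg (States.proj (Consistent S A) i k) (phi b) = b.1 k :=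
  (existsUnique_phi b).choose_spec.1 k

/-- `marg_{∏_{j ≠ i} A_j} [φ_i(b_i)]`. -/
def margOpp {i : I} (b : Consistent S A i) : Bel (Opp A i) :=
  Bel.marg ⟨fun ω => ω.1.2, by fun_prop⟩ (phi b)

/-- `marg_{A_j} [φ_i(b_i)]`, for `j ≠ i`. -/
def margAct {i : I} (b : Consistent S A i) (j : {j : I // j ≠ i}) : Bel (A j) :=
  Bel.marg ⟨fun ω => ω.1.2 j, by fun_prop⟩ (phi b)

/-- `marg_{B_j^{k+1}} [φ_i(b_i)]`, for `j ≠ i`. -/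
def margOrder {i : I} (b : Consistent S A i) (j : {j : I // j ≠ i}) (k : ℕ) :
    Bel (Order S A k j) :=
  Bel.marg ⟨fun ω => (ω.2 j).1 k, (continuous_apply k).comp
    (continuous_subtype_val.comp ((continuous_apply j).comp continuous_snd))⟩ (phi b)

/-- `marg_{A_i} [β]`, for a belief `β ∈ B_j^{k+1}` of an agent `j ≠ i`. -/
def margActOfOrder {j : I} {k : ℕ} (β : Order S A k j) (i : {i : I // i ≠ j}) : Bel (A i) :=
  Bel.marg ((Opp.coord A i).comp (Layer.act S A k j)) β

end Hierarchies

/-! ### The market, dominated responses, and the belief hierarchy sets -/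

/-- A market in reduced form: the state space `S`, the agents `I` and the strategy sets `A` carry
the physical probability measure `P` on `S` and the utility functions `U i`, for which
`U i a : S → ℝ` is a random variable for every strategy profile `a`. -/
structure Market (S : Type u) [MeasurableSpace S] (I : Type v) (A : I → Type w) where
  P : Measure S
  isProb : IsProbabilityMeasure P
  U : I → (∀ j, A j) → S → ℝ
  measurable_U : ∀ i a, Measurable (U i a)

section Responses

variable {S : Type u} [MeasurableSpace S] {I : Type v} {A : I → Type w}

open Classical in
/-- The profile `(a_i, a_{-i})`. -/
def profile {i : I} (x : A i) (y : Opp A i) : ∀ j, A j := fun j =>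
  if h : j = i then h ▸ x else y ⟨j, h⟩

/-- Against `y = a_{-i}`, the strategy `x'` of agent `i` gives a utility that is `P`-a.s. at least
that of `x`, and larger with positive probability. -/
def Market.Improves (M : Market S I A) {i : I} (x' x : A i) (y : Opp A i) : Prop :=
  (∀ᵐ s ∂M.P, M.U i (profile x y) s ≤ M.U i (profile x' y) s) ∧
    0 < M.P {s | M.U i (profile x y) s < M.U i (profile x' y) s}

variable [TopologicalSpace S] [∀ j, TopologicalSpace (A j)]

/-- The strategies in `R` that can be improved, whatever the strategies of the others are, as long
as these are in the support of a hierarchy in `W`. -/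
def Market.dominatedOn (M : Market S I A) {i : I} (R : Set (A i)) (W : Set (Consistent S A i)) :
    Set (A i) :=
  {x ∈ R | ∀ b ∈ W, ∀ y ∈ (margOpp b).supp, ∃ x' : A i, M.Improves x' x y}

/-- Dominated first order responses. -/
def Market.dominatedFirst (M : Market S I A) (i : I) : Set (A i) :=
  {x | ∀ y : Opp A i, ∃ x' : A i, M.Improves x' x y}

/-- For `D j` playing the role of `𝒟_j^{k+1}` and `W` that of `W_i^{k+1}`, the set `V_i^{k+2}`. -/
def nextV (D : ∀ j, Set (A j)) {i : I} (W : Set (Consistent S A i)) : Set (Consistent S A i) :=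
  {b ∈ W | ∀ j : {j : I // j ≠ i}, (margAct b j).IsNull (D j)}

/-- For `D j` playing the role of `𝒟_j^{k+1}` and `W` that of `W_i^{k+1}`, the set `W_i^{k+2}`:
moreover, agent `i` believes that the beliefs of order `k + 1` of the others give probability zero
to `𝒟_i^{k+1}`. -/
def nextW (k : ℕ) (D : ∀ j, Set (A j)) {i : I} (W : Set (Consistent S A i)) :
    Set (Consistent S A i) :=
  {b ∈ nextV D W | ∀ j : {j : I // j ≠ i}, ∀ β ∈ (margOrder b j k).supp,
    (margActOfOrder β ⟨i, j.2.symm⟩).IsNull (D i)}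

/-- The simultaneous recursion: `M.stage k i` is the triple `(𝒰𝒟_i^k, 𝒟_i^{k+1}, W_i^{k+1})`. -/
def Market.stage (M : Market S I A) :
    ℕ → ∀ i : I, Set (A i) × Set (A i) × Set (Consistent S A i)
  | 0, i => (Set.univ, M.dominatedFirst i, Set.univ)
  | k + 1, i =>
    let R := (M.stage k i).1 \ (M.stage k i).2.1
    let W := nextW k (fun j => (M.stage k j).2.1) (M.stage k i).2.2
    (R, M.dominatedOn R W, W)

/-- `𝒰𝒟_i^k`, the undominated responses of order `k`; `𝒰𝒟_i^0 = A_i`. -/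
def Market.undominated (M : Market S I A) (k : ℕ) (i : I) : Set (A i) := (M.stage k i).1

/-- `𝒟_i^k`, the dominated responses of order `k ≥ 1`. -/
def Market.dominated (M : Market S I A) (k : ℕ) (i : I) : Set (A i) := (M.stage (k - 1) i).2.1

/-- `W_i^k`, the belief hierarchy set of order `k ≥ 1`; `W_i^1 = B_i`. -/
def Market.hierarchySet (M : Market S I A) (k : ℕ) (i : I) : Set (Consistent S A i) :=
  (M.stage (k - 1) i).2.2

theorem Market.undominated_zero (M : Market S I A) (i : I) : M.undominated 0 i = Set.univ := rfl

theorem Market.undominated_succ (M : Market S I A) (k : ℕ) (i : I) :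
    M.undominated (k + 1) i = M.undominated k i \ M.dominated (k + 1) i := rfl

theorem Market.dominated_one (M : Market S I A) (i : I) :
    M.dominated 1 i = {x | ∀ y : Opp A i, ∃ x' : A i, M.Improves x' x y} := rfl

theorem Market.dominated_add_two (M : Market S I A) (k : ℕ) (i : I) :
    M.dominated (k + 2) i = {x ∈ M.undominated (k + 1) i | ∀ b ∈ M.hierarchySet (k + 2) i,
      ∀ y ∈ (margOpp b).supp, ∃ x' : A i, M.Improves x' x y} := rfl

theorem Market.hierarchySet_one (M : Market S I A) (i : I) : M.hierarchySet 1 i = Set.univ := rfl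

theorem Market.hierarchySet_add_two (M : Market S I A) (k : ℕ) (i : I) :
    M.hierarchySet (k + 2) i =
      {b ∈ {b ∈ M.hierarchySet (k + 1) i |
          ∀ j : {j : I // j ≠ i}, (margAct b j).IsNull (M.dominated (k + 1) j)} |
        ∀ j : {j : I // j ≠ i}, ∀ β ∈ (margOrder b j k).supp,
          (margActOfOrder β ⟨i, j.2.symm⟩).IsNull (M.dominated (k + 1) i)} := rfl

/-- `A_j(W_i^k)`, the strategies that agent `i` deems plausible for agent `j ≠ i` under hierarchies
in `W_i^k`. -/
def Market.plausible (M : Market S I A) (k : ℕ) {i : I} (j : {j : I // j ≠ i}) : Set (A j) :=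
  {x | ∃ b ∈ M.hierarchySet k i, x ∈ (margAct b j).supp}

end Responses

end Epistemic

end

/-!
The inclusion of the plausible strategies in the closure of the undominated ones holds because a
hierarchy in `W_i^k` gives probability zero to every `𝒟_j^n` with `n < k`, hence to the complement
of `𝒰𝒟_j^{k-1}` (`plausible_subset_closure`).

For the converse, one hierarchy per agent suffices. Choose for every agent `l` a sequence `u_l`
that is dense in `𝒰𝒟_l^{k-1}`, and a law `γ` on `ℕ` that charges every point. It is common
knowledge among the agents that the strategy profile is `(u_l(n))_l` with `n` distributed
according to `γ`. The resulting hierarchies `commonHier` form a belief-closed family of singletons: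
agent `l` believes in the law of the profile and is certain of the hierarchies of the others. The
marginal of the belief on `A_m` is the law of `u_m(n)`, which gives probability zero to every set
disjoint from `𝒰𝒟_m^{k-1}` and whose support contains `𝒰𝒟_m^{k-1}`; and since the others'
beliefs are certain, the condition on their beliefs of finite order follows as well
(`commonBelief_mem_hierarchySet`). Using perfectly correlated beliefs instead of product
measures makes all measures images of `γ`.

For upper semicontinuous utilities, the expectation of a bounded strictly increasing function of
the utility attains its maximum over own strategies by the reverse Fatou lemma, and a maximizer
cannot be improved (`exists_not_improves`). If the maximization is carried out against a profile in
the support of a hierarchy in `W_l^k`, the maximizer belongs to no `𝒟_l^n` with `n ≤ k`, since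
the sets `W_l^n` are nested. As `W_l^k` is nonempty when the sets `𝒰𝒟_l^{k-1}` are, induction
on `k` applies (`undominated_nonempty`).
-/

namespace Epistemic

/-! ### Supports and marginals of beliefs -/

namespace Bel

variable {X Z : Type*} [TopologicalSpace X] [TopologicalSpace Z]

theorem mem_supp_iff {μ : Bel X} {x : X} :
    x ∈ μ.supp ↔ ∀ O : Set X, IsOpen O → x ∈ O → 0 < μ.toMeasure O := by
  let _ : MeasurableSpace X := borel X
  refine ((nhds_basis_opens x).mem_measureSupport (μ := μ.toMeasure)).trans ?_
  exact ⟨fun h O hO hx => h O ⟨hx, hO⟩, fun h O hO => h O hO.2 hO.1⟩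

theorem measurableSet_of_isOpen {O : Set X} (hO : IsOpen O) : MeasurableSet[borel X] O :=
  MeasurableSpace.measurableSet_generateFrom hO

theorem IsNull.mono {μ : Bel X} {E F : Set X} (h : μ.IsNull F) (hEF : E ⊆ F) : μ.IsNull E :=
  let _ : MeasurableSpace X := borel X
  measure_mono_null (μ := μ.toMeasure) hEF h

theorem IsNull.union {μ : Bel X} {E F : Set X} (hE : μ.IsNull E) (hF : μ.IsNull F) :
    μ.IsNull (E ∪ F) :=
  let _ : MeasurableSpace X := borel X
  measure_union_null (μ := μ.toMeasure) hE hF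

theorem supp_subset_closure {μ : Bel X} {E : Set X} (h : μ.IsNull Eᶜ) : μ.supp ⊆ closure E := by
  intro x hx
  by_contra hxE
  have h0 := mem_supp_iff.1 hx (closure E)ᶜ isClosed_closure.isOpen_compl hxE
  exact h0.ne' (h.mono (Set.compl_subset_compl.2 subset_closure))

theorem supp_nonempty [SecondCountableTopology X] (μ : Bel X) : μ.supp.Nonempty := by
  let _ : MeasurableSpace X := borel X
  have : IsProbabilityMeasure μ.toMeasure := μ.2
  exact Measure.nonempty_support (IsProbabilityMeasure.ne_zero μ.toMeasure)

theorem continuous_marg (f : C(X, Z)) : Continuous (marg f) := by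
  let _ : MeasurableSpace X := borel X
  let _ : MeasurableSpace Z := borel Z
  have : BorelSpace X := ⟨rfl⟩
  have : BorelSpace Z := ⟨rfl⟩
  exact ProbabilityMeasure.continuous_map f.continuous

theorem t2Space {X : Type*} [MetricSpace X] : T2Space (Bel X) := by
  let _ : MeasurableSpace X := borel X
  have : BorelSpace X := ⟨rfl⟩
  exact ProbabilityMeasure.t2Space X

/-- A belief that is certain of `c` has only `c` in its support, up to topological
indistinguishability; continuous maps to a T₁ space cannot see the difference. -/
theorem apply_eq_of_mem_supp_const [T1Space Z] {Y : Type*} [TopologicalSpace Y] (μ : Bel Y)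
    {c x : X} (hx : x ∈ (marg (ContinuousMap.const Y c) μ).supp) {h : X → Z}
    (hh : Continuous h) : h x = h c := by
  by_contra hne
  have hO : IsOpen (h ⁻¹' {h c}ᶜ) := isOpen_compl_singleton.preimage hh
  have h0 := mem_supp_iff.1 hx _ hO hne
  rw [marg_apply _ _ (measurableSet_of_isOpen hO)] at h0
  have hempty : (ContinuousMap.const Y c) ⁻¹' (h ⁻¹' {h c}ᶜ) = ∅ := by
    ext y
    simp
  rw [hempty] at h0
  let _ : MeasurableSpace Y := borel Y
  exact h0.ne' (measure_empty (μ := μ.toMeasure))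

theorem exists_bel_nat : ∃ γ : Bel ℕ, ∀ n, 0 < γ.toMeasure {n} := by
  let _ : MeasurableSpace ℕ := borel ℕ
  have : BorelSpace ℕ := ⟨rfl⟩
  refine ⟨⟨(Measure.count : Measure ℕ).toFinite, inferInstance⟩, fun n => ?_⟩
  refine pos_iff_ne_zero.2 fun h => ?_
  simpa using absolutelyContinuous_toFinite (Measure.count : Measure ℕ) h

theorem isNull_marg_of_forall_notMem [T1Space Z] [Countable X] (f : C(X, Z)) (μ : Bel X)
    {E : Set Z} (hE : ∀ n, f n ∉ E) : (marg f μ).IsNull E := by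
  let _ : MeasurableSpace X := borel X
  let _ : MeasurableSpace Z := borel Z
  have : BorelSpace Z := ⟨rfl⟩
  -- `E` need not be measurable, but the countable set `range f` is.
  have hm : MeasurableSet (Set.range f)ᶜ := (Set.countable_range f).measurableSet.compl
  have h0 : (marg f μ).IsNull (Set.range f)ᶜ := by
    refine (marg_apply f μ hm).trans ?_
    have hempty : f ⁻¹' (Set.range f)ᶜ = ∅ := by
      ext
      simp
    rw [hempty, measure_empty]
  refine h0.mono fun z hz => ?_
  rintro ⟨n, rfl⟩
  exact hE n hz

theorem mem_supp_marg_of_mem_closure_range {γ : Bel ℕ} (hγ : ∀ n, 0 < γ.toMeasure {n})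
    (f : C(ℕ, Z)) {z : Z} (hz : z ∈ closure (Set.range f)) : z ∈ (marg f γ).supp := by
  refine mem_supp_iff.2 fun O hO hzO => ?_
  obtain ⟨_, hn, n, rfl⟩ := mem_closure_iff.1 hz O hO hzO
  rw [marg_apply _ _ (measurableSet_of_isOpen hO)]
  let _ : MeasurableSpace ℕ := borel ℕ
  exact (hγ n).trans_le (measure_mono (μ := γ.toMeasure) (Set.singleton_subset_iff.2 hn))

end Bel

/-! ### Hierarchies with a commonly known law of the strategy profile -/

section CommonHierarchies

variable {S : Type u} {I : Type v} {A : I → Type w}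
  [TopologicalSpace S] [∀ j, TopologicalSpace (A j)]

/-- The random element `n ↦ y_l^k(n)` of the layers `Y_l^k` if it is common knowledge that `n` has
law `γ`, the state of nature is `s`, and every agent `m` plays `u m n`. The beliefs of the others,
which are the laws of their own elements of the layers, do not depend on `n`. -/
noncomputable def commonLayer (γ : Bel ℕ) (s : S) (u : ∀ m, ℕ → A m) :
    ∀ (k : ℕ) (l : I), C(ℕ, Layer S A k l)
  | 0, l => (⟨fun n => (s, fun m => u m n), continuous_of_discreteTopology⟩ : C(ℕ, S × Opp A l))
  | k + 1, l =>
    (⟨fun n => (commonLayer γ s u k l n, fun m => Bel.marg (commonLayer γ s u k m) γ),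
      continuous_of_discreteTopology⟩ :
      C(ℕ, Layer S A k l × (∀ m : {m : I // m ≠ l}, Order S A k m)))

/-- The hierarchy of agent `l` if it is common knowledge that the state is `s` and that the
strategy profile is `(u m n)_m`, where `n` has law `γ`. -/
noncomputable def commonHier (γ : Bel ℕ) (s : S) (u : ∀ m, ℕ → A m) (l : I) : Hier S A l :=
  fun k => Bel.marg (commonLayer γ s u k l) γ

/-- The random element of `S × ∏_{m ≠ l} A_m × ∏_{m ≠ l} C_m` whose law is the belief of agent
`l`. -/
noncomputable def commonState (γ : Bel ℕ) (s : S) (u : ∀ m, ℕ → A m)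
    {C : ∀ m : I, Set (Hier S A m)} (hC : ∀ m, commonHier γ s u m ∈ C m) (l : I) :
    C(ℕ, States C l) :=
  ⟨fun n => ((s, fun m => u m n), fun m => ⟨commonHier γ s u m, hC m⟩),
    continuous_of_discreteTopology⟩

theorem proj_comp_commonState (γ : Bel ℕ) (s : S) (u : ∀ m, ℕ → A m)
    {C : ∀ m : I, Set (Hier S A m)} (hC : ∀ m, commonHier γ s u m ∈ C m) (l : I) (k : ℕ) :
    (States.proj C l k).comp (commonState γ s u hC l) = commonLayer γ s u k l := by
  induction k with
  | zero => rfl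
  | succ k ih =>
    ext n
    exact Prod.ext (congrArg (fun f => f n) ih) rfl

theorem coherent_commonHier (γ : Bel ℕ) (s : S) (u : ∀ m, ℕ → A m) (l : I) :
    Coherent (commonHier γ s u l) := fun k =>
  Bel.marg_marg (Layer.down S A k l) (commonLayer γ s u (k + 1) l) γ

theorem commonHier_mem_consistent (γ : Bel ℕ) (s : S) (u : ∀ m, ℕ → A m) (l : I) :
    commonHier γ s u l ∈ Consistent S A l := by
  refine ⟨fun m => {commonHier γ s u m}, ?_, rfl⟩
  rintro m _ rfl
  refine ⟨coherent_commonHier γ s u m, Bel.marg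
    (commonState γ s u (C := fun m => {commonHier γ s u m}) (fun _ => Set.mem_singleton _) m) γ,
    fun k => ?_⟩
  rw [Bel.marg_marg, proj_comp_commonState]
  rfl

/-- `commonHier` as an element of the set of consistent hierarchies. -/
noncomputable def commonBelief (γ : Bel ℕ) (s : S) (u : ∀ m, ℕ → A m) (l : I) :
    Consistent S A l :=
  ⟨commonHier γ s u l, commonHier_mem_consistent γ s u l⟩

theorem phi_commonBelief (γ : Bel ℕ) (s : S) (u : ∀ m, ℕ → A m) (l : I) :
    phi (commonBelief γ s u l) =
      Bel.marg (commonState γ s u (commonHier_mem_consistent γ s u) l) γ := by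
  refine States.bel_ext _ _ fun k => ?_
  rw [marg_phi, Bel.marg_marg, proj_comp_commonState]
  rfl

theorem margAct_commonBelief (γ : Bel ℕ) (s : S) (u : ∀ m, ℕ → A m) {l : I}
    (m : {m : I // m ≠ l}) :
    margAct (commonBelief γ s u l) m =
      Bel.marg ⟨u m, continuous_of_discreteTopology⟩ γ := by
  rw [margAct, phi_commonBelief, Bel.marg_marg]
  rfl

theorem margOrder_commonBelief (γ : Bel ℕ) (s : S) (u : ∀ m, ℕ → A m) {l : I}
    (m : {m : I // m ≠ l}) (k : ℕ) :
    margOrder (commonBelief γ s u l) m k =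
      Bel.marg (ContinuousMap.const ℕ (commonHier γ s u m k)) γ := by
  rw [margOrder, phi_commonBelief, Bel.marg_marg]
  rfl

theorem act_commonLayer (γ : Bel ℕ) (s : S) (u : ∀ m, ℕ → A m) (l : I) (k : ℕ) (n : ℕ) :
    Layer.act S A k l (commonLayer γ s u k l n) = fun m : {m : I // m ≠ l} => u m n := by
  induction k with
  | zero => rfl
  | succ k ih => exact ih

theorem margActOfOrder_commonHier (γ : Bel ℕ) (s : S) (u : ∀ m, ℕ → A m) {l : I}
    (m : {m : I // m ≠ l}) (k : ℕ) :
    margActOfOrder (commonHier γ s u l k) m =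
      Bel.marg ⟨u m, continuous_of_discreteTopology⟩ γ := by
  rw [margActOfOrder, commonHier, Bel.marg_marg]
  congr 1
  ext n
  exact congrFun (act_commonLayer γ s u l k n) m

theorem continuous_margActOfOrder {l : I} (k : ℕ) (m : {m : I // m ≠ l}) :
    Continuous fun β : Order S A k l => margActOfOrder β m :=
  Bel.continuous_marg _

end CommonHierarchies

/-! ### Plausible and undominated strategies -/

namespace Market

variable {S : Type u} [MeasurableSpace S] {I : Type v} {A : I → Type w}

section Recursion

variable [TopologicalSpace S] [∀ j, TopologicalSpace (A j)] (M : Market S I A)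

theorem hierarchySet_succ_subset (k : ℕ) (i : I) :
    M.hierarchySet (k + 1) i ⊆ M.hierarchySet k i := by
  cases k with
  | zero => exact subset_rfl
  | succ k => exact fun b hb => hb.1.1

theorem undominated_antitone (i : I) : Antitone fun k => M.undominated k i :=
  antitone_nat_of_succ_le fun _ _ hx => hx.1

theorem notMem_dominated_of_mem_undominated {k n : ℕ} (h : n < k) (i : I) {x : A i}
    (hx : x ∈ M.undominated k i) : x ∉ M.dominated (n + 1) i :=
  (M.undominated_antitone i h hx).2

theorem plausible_succ_subset (k : ℕ) {i : I} (j : {j : I // j ≠ i}) :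
    M.plausible (k + 1) j ⊆ M.plausible k j := fun _ ⟨b, hb, hx⟩ =>
  ⟨b, M.hierarchySet_succ_subset k i hb, hx⟩

theorem isNull_compl_undominated (k : ℕ) {i : I} (j : {j : I // j ≠ i}) {b : Consistent S A i}
    (hb : b ∈ M.hierarchySet (k + 1) i) : (margAct b j).IsNull (M.undominated k j)ᶜ := by
  induction k with
  | zero =>
    rw [undominated_zero, Set.compl_univ]
    let _ : MeasurableSpace (A j) := borel (A j)
    exact measure_empty (μ := (margAct b j).toMeasure)
  | succ k ih =>
    rw [undominated_succ, Set.sdiff_eq, Set.compl_inter, compl_compl]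
    exact (ih hb.1.1).union (hb.1.2 j)

theorem plausible_subset_closure (k : ℕ) {i : I} (j : {j : I // j ≠ i}) :
    M.plausible (k + 1) j ⊆ closure (M.undominated k j) := fun _ ⟨_, hb, hx⟩ =>
  Bel.supp_subset_closure (M.isNull_compl_undominated k j hb) hx

/-- A strategy that cannot be improved against some profile in the support of a hierarchy in
`W_i^k` survives `k` rounds, because this hierarchy is in all the larger sets `W_i^n` as well. -/
theorem mem_undominated_of_not_improves (k : ℕ) {i : I} {b : Consistent S A i}
    (hb : b ∈ M.hierarchySet k i) {y : Opp A i} (hy : y ∈ (margOpp b).supp) {x : A i}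
    (hx : ∀ x', ¬ M.Improves x' x y) : x ∈ M.undominated k i := by
  induction k with
  | zero => exact Set.mem_univ x
  | succ k ih =>
    refine ⟨ih (M.hierarchySet_succ_subset k i hb), fun hD => ?_⟩
    cases k with
    | zero =>
      obtain ⟨x', h⟩ := hD y
      exact hx x' h
    | succ k =>
      obtain ⟨x', h⟩ := hD.2 b hb y hy
      exact hx x' h

end Recursion

/-- If all strategies played are in the sets `𝒰𝒟_m^k`, which are disjoint from `𝒟_m^1, …, 𝒟_m^k`,
then the common hierarchies pass the first `k` eliminations. -/
theorem commonBelief_mem_hierarchySet [TopologicalSpace S] [∀ l, MetricSpace (A l)]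
    (M : Market S I A) (γ : Bel ℕ) (s : S) {k : ℕ} {u : ∀ m, ℕ → A m}
    (hu : ∀ m n, u m n ∈ M.undominated k m)
    (l : I) : commonBelief γ s u l ∈ M.hierarchySet (k + 1) l := by
  suffices H : ∀ n ≤ k, commonBelief γ s u l ∈ M.hierarchySet (n + 1) l from H k le_rfl
  intro n
  induction n with
  | zero => exact fun _ => Set.mem_univ _
  | succ n ih =>
    intro hn
    refine ⟨⟨ih (Nat.le_of_succ_le hn), fun m => ?_⟩, fun m β hβ => ?_⟩
    · rw [margAct_commonBelief]
      exact Bel.isNull_marg_of_forall_notMem _ _ fun a =>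
        M.notMem_dominated_of_mem_undominated hn m (hu m a)
    · rw [margOrder_commonBelief] at hβ
      have : T2Space (Bel (A l)) := Bel.t2Space
      have h : margActOfOrder β ⟨l, m.2.symm⟩ = margActOfOrder _ ⟨l, m.2.symm⟩ :=
        Bel.apply_eq_of_mem_supp_const γ hβ (continuous_margActOfOrder n ⟨l, m.2.symm⟩)
      rw [h, margActOfOrder_commonHier]
      exact Bel.isNull_marg_of_forall_notMem _ _ fun a =>
        M.notMem_dominated_of_mem_undominated hn l (hu l a)

theorem closure_undominated_subset_plausible [TopologicalSpace S] [Nonempty S]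
    [∀ l, MetricSpace (A l)] [∀ l, SecondCountableTopology (A l)] (M : Market S I A) {k : ℕ}
    (h : ∀ l, (M.undominated k l).Nonempty) {i : I} (j : {j : I // j ≠ i}) :
    closure (M.undominated k j) ⊆ M.plausible (k + 1) j := by
  obtain ⟨γ, hγ⟩ := Bel.exists_bel_nat
  have _ (l : I) : Nonempty (M.undominated k l) := (h l).to_subtype
  let u (l : I) (n : ℕ) : A l := TopologicalSpace.denseSeq (M.undominated k l) n
  refine fun x hx => ⟨commonBelief γ (Classical.arbitrary S) u i,
    M.commonBelief_mem_hierarchySet γ _ (fun m n => Subtype.coe_prop _) i, ?_⟩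
  rw [margAct_commonBelief]
  refine Bel.mem_supp_marg_of_mem_closure_range hγ _ ?_
  have hd : closure (M.undominated k j) ⊆ closure (Set.range (u j)) := by
    have := (TopologicalSpace.denseRange_denseSeq (M.undominated k j)).closure_range
    refine closure_minimal (fun z hz => ?_) isClosed_closure
    have hz' : (⟨z, hz⟩ : M.undominated k j) ∈ closure (Set.range (TopologicalSpace.denseSeq _)) :=
      this ▸ Set.mem_univ _
    have := image_closure_subset_closure_image continuous_subtype_val ⟨_, hz', rfl⟩
    rwa [← Set.range_comp] at this
  exact hd hx

theorem hierarchySet_nonempty [TopologicalSpace S] [Nonempty S] [∀ l, MetricSpace (A l)]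
    (M : Market S I A) {k : ℕ} (h : ∀ l, (M.undominated k l).Nonempty) (i : I) :
    (M.hierarchySet (k + 1) i).Nonempty := by
  obtain ⟨γ, -⟩ := Bel.exists_bel_nat
  choose a ha using h
  exact ⟨_, M.commonBelief_mem_hierarchySet γ (Classical.arbitrary S) (u := fun m _ => a m)
    (fun m _ => ha m) i⟩

/-! ### Upper semicontinuous utilities -/

/-- A form of the reverse Fatou lemma: integration of a bounded family preserves upper
semicontinuity in the parameter. -/
theorem upperSemicontinuous_lintegral {X : Type*} [TopologicalSpace X] [FirstCountableTopology X]
    {μ : Measure S} [IsFiniteMeasure μ] {f : X → S → ENNReal} (hm : ∀ x, Measurable (f x))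
    {c : ENNReal} (hc : c ≠ ⊤) (hfc : ∀ x s, f x s ≤ c)
    (hf : ∀ s, UpperSemicontinuous fun x => f x s) :
    UpperSemicontinuous fun x => ∫⁻ s, f x s ∂μ := by
  intro x y hxy
  by_contra hcon
  obtain ⟨v, hv, hvy⟩ := Filter.exists_seq_forall_of_frequently (Filter.not_eventually.1 hcon)
  refine hxy.not_ge ?_
  calc y ≤ Filter.limsup (fun n => ∫⁻ s, f (v n) s ∂μ) Filter.atTop :=
        Filter.le_limsup_of_frequently_le
          (Filter.Frequently.of_forall fun n => not_lt.1 (hvy n))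
    _ ≤ ∫⁻ s, Filter.limsup (fun n => f (v n) s) Filter.atTop ∂μ :=
        limsup_lintegral_le (fun _ => c) (fun n => hm (v n))
          (fun n => Filter.Eventually.of_forall (hfc (v n)))
          (by simpa using ENNReal.mul_ne_top hc (measure_ne_top μ _))
    _ ≤ ∫⁻ s, f x s ∂μ := lintegral_mono fun s =>
        (Filter.limsup_le_limsup_of_le (f := Filter.map v Filter.atTop) (u := fun x => f x s)
          hv).trans (upperSemicontinuousAt_iff_limsup_le.1 (hf s x))

/-- A strategy that maximizes the expectation of a bounded, strictly increasing function of the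
utility cannot be improved. -/
theorem exists_not_improves [∀ l, MetricSpace (A l)] (M : Market S I A) {i : I}
    [CompactSpace (A i)] [Nonempty (A i)] (y : Opp A i)
    (hU : ∀ s, UpperSemicontinuous fun x : A i => M.U i (profile x y) s) :
    ∃ x : A i, ∀ x', ¬ M.Improves x' x y := by
  have := M.isProb
  -- The summand `2` makes the function positive, hence strictly increasing with values in `ℝ≥0∞`.
  let g (t : ℝ) : ENNReal := ENNReal.ofReal (Real.arctan t + 2)
  have hpos (t : ℝ) : 0 < Real.arctan t + 2 := by
    linarith [Real.neg_pi_div_two_lt_arctan t, Real.pi_lt_four]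
  have hg : StrictMono g := fun t t' h =>
    (ENNReal.ofReal_lt_ofReal_iff (hpos t')).2 (by linarith [Real.arctan_strictMono h])
  have hgc : Continuous g :=
    ENNReal.continuous_ofReal.comp (Real.continuous_arctan.add continuous_const)
  have hg4 (t : ℝ) : g t ≤ ENNReal.ofReal 4 := ENNReal.ofReal_le_ofReal (by
    linarith [Real.arctan_lt_pi_div_two t, Real.pi_lt_four])
  have hm (x : A i) : Measurable fun s => g (M.U i (profile x y) s) :=
    hgc.measurable.comp (M.measurable_U i _)
  have hF : UpperSemicontinuous fun x : A i => ∫⁻ s, g (M.U i (profile x y) s) ∂M.P :=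
    upperSemicontinuous_lintegral hm ENNReal.ofReal_ne_top (fun x s => hg4 _) fun s =>
      hgc.comp_upperSemicontinuous (hU s) hg.monotone
  obtain ⟨x, -, hx⟩ :=
    (hF.upperSemicontinuousOn Set.univ).exists_isMaxOn Set.univ_nonempty isCompact_univ
  refine ⟨x, fun x' h => ?_⟩
  have hle : ∫⁻ s, g (M.U i (profile x' y) s) ∂M.P ≤ ∫⁻ s, g (M.U i (profile x y) s) ∂M.P :=
    hx (Set.mem_univ x')
  refine hle.not_gt ?_
  refine lintegral_strict_mono_of_ae_le_of_ae_lt_on (hm x').aemeasurable ?_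
    (h.1.mono fun s hs => hg.monotone hs) h.2.ne' (Filter.Eventually.of_forall fun s hs => hg hs)
  refine ne_top_of_le_ne_top ?_ (lintegral_mono fun s => hg4 (M.U i (profile x y) s))
  simp

theorem undominated_nonempty [TopologicalSpace S] [Nonempty S] [Countable I]
    [∀ l, MetricSpace (A l)] [∀ l, CompactSpace (A l)] [∀ l, Nonempty (A l)] (M : Market S I A)
    (hU : ∀ (l : I) (y : Opp A l) (s : S),
      UpperSemicontinuous fun x : A l => M.U l (profile x y) s) (k : ℕ) (l : I) :
    (M.undominated k l).Nonempty := by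
  induction k generalizing l with
  | zero => exact Set.univ_nonempty
  | succ k ih =>
    obtain ⟨b, hb⟩ := M.hierarchySet_nonempty ih l
    obtain ⟨y, hy⟩ := (margOpp b).supp_nonempty
    obtain ⟨x, hx⟩ := M.exists_not_improves y (hU l y)
    exact ⟨x, M.mem_undominated_of_not_improves (k + 1) hb hy hx⟩

end Market

end Epistemic

theorem mainTheorem8 {S : Type u} [MetricSpace S] [CompactSpace S] [MeasurableSpace S]
    [BorelSpace S] {I : Type v} [Finite I] {A : I → Type w} [∀ l, MetricSpace (A l)]
    [∀ l, CompactSpace (A l)] [∀ l, Nonempty (A l)] (M : Epistemic.Market S I A)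
    (i : I) (j : {j : I // j ≠ i}) :
    -- the sets `A_j(W_i^k)` are nested
    (∀ k ≥ 1, M.plausible (k + 1) j ⊆ M.plausible k j) ∧
    -- they are given by the undominated sets
    (∀ k ≥ 1, (∀ l, (M.undominated (k - 1) l).Nonempty) →
      M.plausible k j = closure (M.undominated (k - 1) j)) ∧
    (∀ k ≥ 1, (∀ l, (M.undominated (k - 1) l).Nonempty) →
      (M.plausible k j = M.undominated (k - 1) j ↔ IsClosed (M.undominated (k - 1) j))) ∧
    -- the undominated sets are nonempty when utilities are upper semicontinuous in own strategies
    ((∀ (l : I) (y : Epistemic.Opp A l) (s : S),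
        UpperSemicontinuous fun x : A l => M.U l (Epistemic.profile x y) s) →
      ∀ k l, (M.undominated k l).Nonempty) := by
  have := M.isProb
  have : Nonempty S := nonempty_of_isProbabilityMeasure M.P
  have key : ∀ k ≥ 1, (∀ l, (M.undominated (k - 1) l).Nonempty) →
      M.plausible k j = closure (M.undominated (k - 1) j) := by
    intro k hk h
    obtain ⟨k, rfl⟩ := Nat.exists_eq_add_of_le' hk
    exact (M.plausible_subset_closure k j).antisymm (M.closure_undominated_subset_plausible h j)
  refine ⟨fun k _ => M.plausible_succ_subset k j, key, fun k hk h => ?_, M.undominated_nonempty⟩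
  rw [key k hk h]
  exact closure_eq_iff_isClosed
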